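/- Let $\mathbb{H}=\{\tau\in\mathbb{C}:\operatorname{Im}\tau>0\}$. For $\epsilon,\epsilon'\in\mathbb{R}$, $v\in\mathbb{C}$ and $\tau\in\mathbb{H}$ put $$\theta\begin{bmatrix}\epsilon\\ \epsilon'\end{bmatrix}(v,\tau)=\sum_{n\in\mathbb{Z}}\exp\Bigl(2\pi i\Bigl[\tfrac12\bigl(n+\tfrac{\epsilon}{2}\bigr)^2\tau+\bigl(n+\tfrac{\epsilon}{2}\bigr)\bigl(v+\tfrac{\epsilon'}{2}\bigr)\Bigr]\Bigr).$$ Let $$\Gamma_{\theta,5}=\Bigl\{M\in SL(2,\mathbb{Z}) : M\equiv \pm\begin{pmatrix}1&0\\0&1\end{pmatrix}\text{ or } M\equiv\pm\begin{pmatrix}0&-1\\1&0\end{pmatrix} \pmod 5\Bigr\}.$$ For a subgroup $\Gamma\subseteq SL(2,\mathbb{Z})$ and real $k$, a modular form of weight $k$ on $\Gamma$ with multiplier system $\nu$ is a function $f:\mathbb{H}\to\mathbb{C}$, not identically zero, holomorphic on $\mathbb{H}$ and at all cusps (that is, $(c\tau+d)^{-k}f(M\tau)$ is bounded as $\operatorname{Im}\tau\to\infty$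 for each $M=\begin{pmatrix}a&b\\c&d\end{pmatrix}\in SL(2,\mathbb{Z})$), such that for all $M=\begin{pmatrix}a&b\\c&d\end{pmatrix}\in\Gamma$ and $\tau\in\mathbb{H}$ $$f\Bigl(\frac{a\tau+b}{c\tau+d}\Bigr)=\nu(M)\,(c\tau+d)^k f(\tau),$$ where $|\nu(M)|=1$ on $\Gamma$ and $\nu$ satisfies the corresponding consistency condition $\nu(MN)\,j(MN,\tau)=\nu(M)\nu(N)\,j(M,N\tau)\,j(N,\tau)$ for $M,N\in\Gamma$, with $j(M,\tau)=(c\tau+d)^k$; powers are taken with the principal branch. The Dedekind eta function $\eta(\tau)=e^{2\pi i\tau/24}\prod_{n\ge1}(1-e^{2\pi i n\tau})$ is a modular form of weight $1/2$ on $SL(2,\mathbb{Z})$ with a multiplier system $\nu_\eta$, which is uniquely determined by $\eta$. Moreover, the function $$\theta\begin{bmatrix}1/5\\1/5\end{bmatrix}(0,\tau)\;\theta\begin{bmatrix}1/5\\9/5\end{bmatrix}(0,\tau)$$ is a modular form of weight $1$ on $\Gamma_{\theta,5}$ whose multiplier system is given, for $M=\begin{pmatrix}a&b\\c&d\end{pmatrix}\in\Gamma_{\theta,5}$,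 by $$\nu(M)=\nu_\eta(M)^6\,\exp\Bigl(\frac{\pi i}{5}E\Bigr),$$ where $$E=\begin{cases} -\frac{4b}{5}-\frac{8ab}{5}-\frac{8cd}{5} & \text{if } M\equiv\begin{pmatrix}1&0\\0&1\end{pmatrix}\pmod 5,\\[1mm] -\frac{6b}{5}-\frac{8ab}{5}-\frac{8cd}{5} & \text{if } M\equiv\begin{pmatrix}-1&0\\0&-1\end{pmatrix}\pmod 5,\\[1mm] -5-\frac{4d}{5}-\frac{8ab}{5}-\frac{8cd}{5} & \text{if } M\equiv\begin{pmatrix}0&-1\\1&0\end{pmatrix}\pmod 5,\\[1mm] -5+\frac{4d}{5}-\frac{8ab}{5}-\frac{8cd}{5} & \text{if } M\equiv\begin{pmatrix}0&1\\-1&0\end{pmatrix}\pmod 5. \end{cases}$$ -/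

import Mathlib

open UpperHalfPlane MatrixGroups

namespace ThetaLevelFive

noncomputable section

/-- The theta function with real characteristics `ε, ε'`:
`∑_{n ∈ ℤ} exp (2πi [ (n + ε/2)² τ / 2 + (n + ε/2) (v + ε'/2) ])`. -/
def thetaChar (ε ε' : ℝ) (v : ℂ) (τ : ℍ) : ℂ :=
  ∑' n : ℤ, Complex.exp (2 * (Real.pi : ℂ) * Complex.I *
    (1 / 2 * ((n : ℂ) + (ε : ℂ) / 2) ^ 2 * (τ : ℂ)
      + ((n : ℂ) + (ε : ℂ) / 2) * (v + (ε' : ℂ) / 2)))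

/-- The product of theta constants `θ[1/5, 1/5](0, τ) · θ[1/5, 9/5](0, τ)`. -/
def thetaProd (τ : ℍ) : ℂ :=
  thetaChar (1 / 5) (1 / 5) 0 τ * thetaChar (1 / 5) (9 / 5) 0 τ

/-- Entrywise congruence of integral `2 × 2` matrices modulo `5`. -/
def Cong5 (A B : Matrix (Fin 2) (Fin 2) ℤ) : Prop :=
  ∀ i j, A i j ≡ B i j [ZMOD 5]

/-- The theta group of level `5`: the matrices in `SL(2, ℤ)` which are congruent modulo `5` to
one of `±I`, `±S`, where `S = (0, -1; 1, 0)`. -/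
def GammaTheta5 : Subgroup SL(2, ℤ) where
  carrier := {M | Cong5 M.1 !![1, 0; 0, 1] ∨ Cong5 M.1 !![-1, 0; 0, -1] ∨
    Cong5 M.1 !![0, -1; 1, 0] ∨ Cong5 M.1 !![0, 1; -1, 0]}
  one_mem' := by
    left
    intro i j
    fin_cases i <;> fin_cases j <;> simp
  mul_mem' := by
    have key : ∀ (A B C D : Matrix (Fin 2) (Fin 2) ℤ), Cong5 A C → Cong5 B D →
        Cong5 (A * B) (C * D) := by
      intro A B C D h1 h2 i j
      rw [Matrix.mul_apply, Matrix.mul_apply, Fin.sum_univ_two, Fin.sum_univ_two]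
      exact ((h1 i 0).mul (h2 0 j)).add ((h1 i 1).mul (h2 1 j))
    rintro M N (hM | hM | hM | hM) (hN | hN | hN | hN) <;>
    · have h := key _ _ _ _ hM hN
      simp only [Set.mem_ofPred_eq, Matrix.SpecialLinearGroup.coe_mul]
      simp at h
      tauto
  inv_mem' := by
    rintro M (h | h | h | h)
    · left
      intro i j
      have h0 := h 0 0; have h1 := h 0 1; have h2 := h 1 0; have h3 := h 1 1
      fin_cases i <;> fin_cases j <;>
        simp [Matrix.SpecialLinearGroup.SL2_inv_expl, Int.ModEq] at * <;> omega
    · right; left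
      intro i j
      have h0 := h 0 0; have h1 := h 0 1; have h2 := h 1 0; have h3 := h 1 1
      fin_cases i <;> fin_cases j <;>
        simp [Matrix.SpecialLinearGroup.SL2_inv_expl, Int.ModEq] at * <;> omega
    · right; right; right
      intro i j
      have h0 := h 0 0; have h1 := h 0 1; have h2 := h 1 0; have h3 := h 1 1
      fin_cases i <;> fin_cases j <;>
        simp [Matrix.SpecialLinearGroup.SL2_inv_expl, Int.ModEq] at * <;> omega
    · right; right; left
      intro i j
      have h0 := h 0 0; have h1 := h 0 1; have h2 := h 1 0; have h3 := h 1 1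
      fin_cases i <;> fin_cases j <;>
        simp [Matrix.SpecialLinearGroup.SL2_inv_expl, Int.ModEq] at * <;> omega

/-- The factor `(cτ + d)^k`, with the principal branch of the power. -/
def autFactor (k : ℝ) (M : SL(2, ℤ)) (τ : ℍ) : ℂ :=
  ((M 1 0 : ℂ) * (τ : ℂ) + (M 1 1 : ℂ)) ^ (k : ℂ)

/-- `f` is a (nonzero) modular form of real weight `k` on the subgroup `Γ` of `SL(2, ℤ)` and
`ν` is its multiplier system. -/
structure IsModularFormWithMultiplier (Γ : Subgroup SL(2, ℤ)) (k : ℝ) (f : ℍ → ℂ)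
    (ν : SL(2, ℤ) → ℂ) : Prop where
  /-- `f` is holomorphic on the upper half plane. -/
  holo : DifferentiableOn ℂ (fun z : ℂ => f (UpperHalfPlane.ofComplex z)) {z : ℂ | 0 < z.im}
  /-- `f` is holomorphic at every cusp. -/
  bdd_at_cusps : ∀ M : SL(2, ℤ),
    IsBoundedAtImInfty (fun τ : ℍ => f (M • τ) / autFactor k M τ)
  /-- `f` does not vanish identically, so that `ν` is determined on `Γ` by `f`. -/
  ne_zero : ∃ τ : ℍ, f τ ≠ 0
  /-- `ν` is unitary on `Γ`. -/
  norm_eq_one : ∀ M ∈ Γ, ‖ν M‖ = 1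
  /-- The consistency condition for multiplier systems of weight `k`. -/
  consistent : ∀ M ∈ Γ, ∀ N ∈ Γ, ∀ τ : ℍ,
    ν (M * N) * autFactor k (M * N) τ =
      ν M * ν N * autFactor k M (N • τ) * autFactor k N τ
  /-- The transformation law `f(Mτ) = ν(M) (cτ + d)^k f(τ)`. -/
  transform : ∀ M ∈ Γ, ∀ τ : ℍ, f (M • τ) = ν M * autFactor k M τ * f τ

/-- The Dedekind eta function on the upper half plane. -/
def etaH (τ : ℍ) : ℂ := ModularForm.eta (τ : ℂ)

/-- The multiplier system `ν_η` of the Dedekind eta function: the ratio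
`η(Mτ) / ((cτ + d)^{1/2} η(τ))`, which does not depend on `τ`, evaluated at `τ = i`. -/
def nuEta (M : SL(2, ℤ)) : ℂ :=
  etaH (M • UpperHalfPlane.I) / (autFactor (1 / 2) M UpperHalfPlane.I * etaH UpperHalfPlane.I)

open Classical in
/-- The exponent `E`; the last branch does not occur on the theta group of level `5`. -/
def exponentE (M : SL(2, ℤ)) : ℝ :=
  let a : ℝ := M 0 0
  let b : ℝ := M 0 1
  let c : ℝ := M 1 0
  let d : ℝ := M 1 1
  if Cong5 M.1 !![1, 0; 0, 1] then
    -(4 * b / 5) - 8 * a * b / 5 - 8 * c * d / 5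
  else if Cong5 M.1 !![-1, 0; 0, -1] then
    -(6 * b / 5) - 8 * a * b / 5 - 8 * c * d / 5
  else if Cong5 M.1 !![0, -1; 1, 0] then
    -5 - 4 * d / 5 - 8 * a * b / 5 - 8 * c * d / 5
  else if Cong5 M.1 !![0, 1; -1, 0] then
    -5 + 4 * d / 5 - 8 * a * b / 5 - 8 * c * d / 5
  else 0

end

end ThetaLevelFive

/-!
For the eta function, `η ^ 24` is the discriminant, a modular form of weight `12` and level one.
Hence the quotient `η(Mτ) / ((cτ + d)^{1/2} η(τ))` is a continuous function of `τ` with values in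
the `24`-th roots of unity, so it is constant and equal to `ν_η(M)` (`etaRatio_eq_nuEta`).

For the product of theta constants, put `r = (r₁, r₂)` and let `ϑ_r` be the theta constant with
characteristic `[1 + 2r₁, 1 + 2r₂]`, multiplied by `exp (-πi r₁ (r₂ + 1))`. Up to a constant,
`K_r = ϑ_r / η ^ 3` is a Klein form: it satisfies `K_r(Mτ) (cτ + d) = K_{rM}(τ)` for every `M` in
`SL(2, ℤ)` and every real row vector `r`, without any root of unity (`kleinForm_smul`). As this
relation is compatible with products, it need only be checked on the generators `T`, where it can
be read off the series, and `S`, where it is the functional equation of the Jacobi theta function.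

The given function is a constant times `ϑ_r ϑ_s` with `r = (-2/5, -2/5)` and `s = (-2/5, 2/5)`, that
is, a constant times `η ^ 6 K_r K_s`. So it acquires the factor `ν_η(M) ^ 6 (cτ + d) ^ 3` from
`η ^ 6`, and `(cτ + d) ^ (-2)` from the Klein forms (`thetaProd_smul`). For `M` in the theta group
of level `5`, the vectors `rM` and `sM` agree modulo `2ℤ × 2ℤ` with `±r` and `±s` in some order, so
the quasi-periodicity of `ϑ` and `ϑ_{-r} = -ϑ_r` yield the explicit exponential
(`kleinTheta_mul_kleinTheta`).

At the cusps, `thetaProd_smul` reduces boundedness to that of theta constants as `Im τ → ∞`, where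
the absolute value of each term of the series decreases. The function is not identically zero since
each of the two series is dominated by its term `n = 0` when `Im τ` is large
(`eventually_thetaChar_ne_zero`).
-/

namespace ThetaLevelFive

noncomputable section

/-! ### The factor of automorphy -/

/-- The integral factor of automorphy `cτ + d`. -/
def lowerRow (M : SL(2, ℤ)) (τ : ℍ) : ℂ := (M 1 0 : ℂ) * (τ : ℂ) + (M 1 1 : ℂ)

lemma lowerRow_eq_denom (M : SL(2, ℤ)) (τ : ℍ) : lowerRow M τ = denom M τ := by
  rw [ModularGroup.denom_apply]
  simp [lowerRow]

lemma lowerRow_ne_zero (M : SL(2, ℤ)) (τ : ℍ) : lowerRow M τ ≠ 0 := by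
  rw [lowerRow_eq_denom]
  exact denom_ne_zero _ τ

lemma coe_smul_eq_div (M : SL(2, ℤ)) (τ : ℍ) :
    ((M • τ : ℍ) : ℂ) = ((M 0 0 : ℂ) * τ + (M 0 1 : ℂ)) / lowerRow M τ := by
  rw [coe_specialLinearGroup_apply]
  simp [lowerRow]

lemma lowerRow_mul (M N : SL(2, ℤ)) (τ : ℍ) :
    lowerRow (M * N) τ = lowerRow M (N • τ) * lowerRow N τ := by
  have h := lowerRow_ne_zero N τ
  conv_rhs => rw [lowerRow, coe_smul_eq_div]
  field_simp
  simp only [lowerRow, Matrix.SpecialLinearGroup.coe_mul, Matrix.mul_apply, Fin.sum_univ_two]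
  push_cast
  ring

lemma autFactor_one (M : SL(2, ℤ)) (τ : ℍ) : autFactor 1 M τ = lowerRow M τ := by
  simp [autFactor, lowerRow]

lemma autFactor_ne_zero (k : ℝ) (M : SL(2, ℤ)) (τ : ℍ) : autFactor k M τ ≠ 0 :=
  fun h => lowerRow_ne_zero M τ (Complex.cpow_eq_zero_iff _ _ |>.mp h).1

lemma autFactor_half_sq (M : SL(2, ℤ)) (τ : ℍ) : autFactor (1 / 2) M τ ^ 2 = lowerRow M τ := by
  rw [autFactor, ← Complex.cpow_nat_mul]
  simp [lowerRow]

lemma continuous_autFactor (k : ℝ) (M : SL(2, ℤ)) : Continuous (autFactor k M) := by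
  unfold autFactor
  -- for `c = 0` the base is the constant `d`, which may lie on the branch cut
  by_cases hc : M 1 0 = 0
  · simp [hc, continuous_const]
  · refine continuous_iff_continuousAt.mpr fun τ => ?_
    refine ContinuousAt.cpow (by fun_prop) continuousAt_const ?_
    refine Complex.mem_slitPlane_iff.mpr (Or.inr ?_)
    simp [hc, τ.im_ne_zero]

/-! ### The eta function -/

lemma etaH_ne_zero (τ : ℍ) : etaH τ ≠ 0 := ModularForm.eta_ne_zero τ.2

lemma etaH_smul_pow (M : SL(2, ℤ)) (τ : ℍ) :
    etaH (M • τ) ^ 24 = lowerRow M τ ^ 12 * etaH τ ^ 24 := by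
  have h := congrFun (SlashInvariantForm.slash_action_generators_SL2Z
    ModularForm.discriminant_S_invariant ModularForm.discriminant_T_invariant M) τ
  rw [ModularForm.SL_slash_apply, ← lowerRow_eq_denom] at h
  have h0 := lowerRow_ne_zero M τ
  simp only [ModularForm.discriminant, zpow_neg] at h
  simp only [etaH]
  rw [← h]
  have : lowerRow M τ ^ (12 : ℤ) = lowerRow M τ ^ 12 := by norm_cast
  rw [this]
  field_simp

/-- The quotient `η(Mτ) / ((cτ + d)^{1/2} η(τ))`. -/
def etaRatio (M : SL(2, ℤ)) (τ : ℍ) : ℂ := etaH (M • τ) / (autFactor (1 / 2) M τ * etaH τ)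

/-- `η ^ 24` is the discriminant, a modular form of weight `12` and level one. -/
lemma etaRatio_pow (M : SL(2, ℤ)) (τ : ℍ) : etaRatio M τ ^ 24 = 1 := by
  have h0 := lowerRow_ne_zero M τ
  have h1 := etaH_ne_zero τ
  have h2 : autFactor (1 / 2) M τ ^ 24 = lowerRow M τ ^ 12 := by
    rw [← autFactor_half_sq]; ring
  rw [etaRatio, div_pow, mul_pow, h2, etaH_smul_pow]
  field_simp

lemma continuous_etaH : Continuous etaH :=
  continuous_iff_continuousAt.mpr fun τ =>
    (ModularForm.differentiableAt_eta_of_mem_upperHalfPlaneSet τ.2).continuousAt.comp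
      UpperHalfPlane.continuous_coe.continuousAt

lemma continuous_SL_smul (M : SL(2, ℤ)) : Continuous fun τ : ℍ => M • τ := by
  rw [UpperHalfPlane.isEmbedding_coe.continuous_iff]
  have : (fun τ : ℍ => ((M • τ : ℍ) : ℂ)) =
      fun τ : ℍ => ((M 0 0 : ℂ) * τ + (M 0 1 : ℂ)) / lowerRow M τ :=
    funext (coe_smul_eq_div M)
  simp only [Function.comp_def, this]
  refine Continuous.div (by fun_prop) ?_ (lowerRow_ne_zero M)
  unfold lowerRow
  fun_prop

lemma continuous_etaRatio (M : SL(2, ℤ)) : Continuous (etaRatio M) :=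
  (continuous_etaH.comp (continuous_SL_smul M)).div
    ((continuous_autFactor _ M).mul continuous_etaH)
    fun τ => mul_ne_zero (autFactor_ne_zero _ M τ) (etaH_ne_zero τ)

/-- A continuous function on the connected space `ℍ` with values in the `24`-th roots of unity
is constant. -/
lemma etaRatio_eq_nuEta (M : SL(2, ℤ)) (τ : ℍ) : etaRatio M τ = nuEta M := by
  have hfin : {z : ℂ | z ^ 24 = 1}.Finite := by
    refine (Polynomial.nthRootsFinset 24 (1 : ℂ)).finite_toSet.subset fun z hz => ?_
    simpa [Polynomial.mem_nthRootsFinset] using hz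
  exact isPreconnected_univ.constant_of_mapsTo hfin.isDiscrete
    (continuous_etaRatio M).continuousOn (fun τ _ => etaRatio_pow M τ)
    (Set.mem_univ τ) (Set.mem_univ UpperHalfPlane.I)

lemma norm_nuEta (M : SL(2, ℤ)) : ‖nuEta M‖ = 1 :=
  Complex.norm_eq_one_of_pow_eq_one (etaRatio_eq_nuEta M UpperHalfPlane.I ▸ etaRatio_pow M _)
    (by norm_num : (24 : ℕ) ≠ 0)

lemma etaH_smul (M : SL(2, ℤ)) (τ : ℍ) :
    etaH (M • τ) = nuEta M * autFactor (1 / 2) M τ * etaH τ := by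
  have h1 := etaH_ne_zero τ
  have h2 := autFactor_ne_zero (1 / 2) M τ
  rw [← etaRatio_eq_nuEta M τ, etaRatio]
  field_simp

lemma etaH_isBoundedAtImInfty : IsBoundedAtImInfty etaH := by
  obtain ⟨C, A, h⟩ := isBoundedAtImInfty_iff.mp
    ModularForm.discriminant_isZeroAtImInfty.isBoundedAtImInfty
  refine isBoundedAtImInfty_iff.mpr ⟨max 1 C, A, fun τ hτ => ?_⟩
  have h24 : ‖etaH τ‖ ^ 24 ≤ C := by
    simpa [ModularForm.discriminant, etaH] using h τ hτ
  by_contra! hlt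
  have h1 : 1 ≤ ‖etaH τ‖ := (le_max_left _ _).trans hlt.le
  have := le_self_pow₀ h1 (show (24 : ℕ) ≠ 0 by norm_num)
  linarith [le_max_right 1 C]

theorem eta_isModularForm : IsModularFormWithMultiplier ⊤ (1 / 2) etaH nuEta where
  holo z hz := by
    refine ((ModularForm.differentiableAt_eta_of_mem_upperHalfPlaneSet
      hz).differentiableWithinAt).congr (fun w hw => ?_) ?_
    · simp [etaH, ofComplex_apply_of_im_pos hw]
    · simp [etaH, ofComplex_apply_of_im_pos hz]
  bdd_at_cusps M := by
    obtain ⟨C, A, h⟩ := isBoundedAtImInfty_iff.mp etaH_isBoundedAtImInfty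
    refine isBoundedAtImInfty_iff.mpr ⟨C, A, fun τ hτ => ?_⟩
    have h2 := autFactor_ne_zero (1 / 2) M τ
    rw [etaH_smul, mul_right_comm, mul_div_assoc, div_self h2, mul_one, norm_mul, norm_nuEta,
      one_mul]
    exact h τ hτ
  ne_zero := ⟨UpperHalfPlane.I, etaH_ne_zero _⟩
  norm_eq_one M _ := norm_nuEta M
  consistent M _ N _ τ := by
    refine mul_right_cancel₀ (etaH_ne_zero τ) ?_
    rw [← etaH_smul, mul_smul, etaH_smul, etaH_smul]
    ring
  transform M _ τ := etaH_smul M τ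
/-! ### Theta constants with real characteristics -/

/-- The general term of the series of the theta constant `θ[ε, ε'](0, τ)`. -/
def thetaTerm (ε ε' : ℝ) (τ : ℍ) (n : ℤ) : ℂ :=
  Complex.exp (2 * (Real.pi : ℂ) * Complex.I *
    (1 / 2 * ((n : ℂ) + (ε : ℂ) / 2) ^ 2 * (τ : ℂ)
      + ((n : ℂ) + (ε : ℂ) / 2) * (0 + (ε' : ℂ) / 2)))

lemma thetaChar_eq_tsum (ε ε' : ℝ) (τ : ℍ) :
    thetaChar ε ε' 0 τ = ∑' n : ℤ, thetaTerm ε ε' τ n := rfl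

lemma thetaTerm_eq (ε ε' : ℝ) (τ : ℍ) (n : ℤ) :
    thetaTerm ε ε' τ n =
      Complex.exp (Real.pi * Complex.I * ((ε / 2) ^ 2 * τ + ε * ε' / 2)) *
        jacobiTheta₂_term n (ε / 2 * τ + ε' / 2) τ := by
  rw [thetaTerm, jacobiTheta₂_term, ← Complex.exp_add]
  congr 1
  ring

lemma summable_thetaTerm (ε ε' : ℝ) (τ : ℍ) : Summable (thetaTerm ε ε' τ) := by
  rw [funext (thetaTerm_eq ε ε' τ)]
  exact ((summable_jacobiTheta₂_term_iff _ _).mpr τ.2).mul_left _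

/-- A theta constant is, up to an exponential, a value of the two-variable Jacobi theta function
at a point whose coordinates with respect to `τ, 1` are real constants. -/
lemma thetaChar_eq_jacobiTheta₂ (ε ε' : ℝ) (τ : ℍ) :
    thetaChar ε ε' 0 τ =
      Complex.exp (Real.pi * Complex.I * ((ε / 2) ^ 2 * τ + ε * ε' / 2)) *
        jacobiTheta₂ (ε / 2 * τ + ε' / 2) τ := by
  rw [thetaChar_eq_tsum, funext (thetaTerm_eq ε ε' τ), tsum_mul_left]
  rfl

lemma norm_thetaTerm (ε ε' : ℝ) (τ : ℍ) (n : ℤ) :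
    ‖thetaTerm ε ε' τ n‖ = Real.exp (-Real.pi * (n + ε / 2) ^ 2 * τ.im) := by
  rw [thetaTerm, Complex.norm_exp]
  congr 1
  have : 2 * (Real.pi : ℂ) * Complex.I * (1 / 2 * ((n : ℂ) + (ε : ℂ) / 2) ^ 2 * (τ : ℂ)
      + ((n : ℂ) + (ε : ℂ) / 2) * (0 + (ε' : ℂ) / 2)) =
      ((Real.pi * (n + ε / 2) ^ 2 : ℝ) : ℂ) * (τ * Complex.I) +
        ((Real.pi * (n + ε / 2) * ε' : ℝ) : ℂ) * Complex.I := by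
    push_cast
    ring
  rw [this, Complex.add_re, Complex.re_ofReal_mul, Complex.re_ofReal_mul]
  simp

lemma differentiableOn_thetaChar (ε ε' : ℝ) :
    DifferentiableOn ℂ (fun z : ℂ => thetaChar ε ε' 0 (ofComplex z)) {z : ℂ | 0 < z.im} := by
  have key : DifferentiableOn ℂ (fun z : ℂ =>
      Complex.exp (Real.pi * Complex.I * ((ε / 2) ^ 2 * z + ε * ε' / 2)) *
        jacobiTheta₂ (ε / 2 * z + ε' / 2) z) {z : ℂ | 0 < z.im} := by
    intro z hz
    refine DifferentiableAt.differentiableWithinAt (DifferentiableAt.mul (by fun_prop) ?_)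
    exact (hasFDerivAt_jacobiTheta₂ (ε / 2 * z + ε' / 2) hz).differentiableAt.comp z
      (f := fun z : ℂ => ((ε / 2 * z + ε' / 2 : ℂ), z)) (by fun_prop)
  refine key.congr fun z hz => ?_
  rw [thetaChar_eq_jacobiTheta₂, ofComplex_apply_of_im_pos hz]

/-- The absolute value of each term of the series decreases with `Im τ`. -/
lemma thetaChar_isBoundedAtImInfty (ε ε' : ℝ) :
    IsBoundedAtImInfty fun τ => thetaChar ε ε' 0 τ := by
  have hI := (summable_thetaTerm ε ε' UpperHalfPlane.I).norm
  refine isBoundedAtImInfty_iff.mpr ⟨∑' n, ‖thetaTerm ε ε' UpperHalfPlane.I n‖, 1, fun τ hτ => ?_⟩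
  refine tsum_of_norm_bounded hI.hasSum fun n => ?_
  change ‖thetaTerm ε ε' τ n‖ ≤ _
  rw [norm_thetaTerm, norm_thetaTerm, UpperHalfPlane.I_im]
  refine Real.exp_le_exp.mpr ?_
  have : 0 ≤ Real.pi * (n + ε / 2) ^ 2 := by positivity
  nlinarith

/-- For `|ε| < 1` the term `n = 0` dominates the theta series as `τ → i∞`. -/
lemma eventually_thetaChar_ne_zero {ε : ℝ} (hε : |ε| < 1) (ε' : ℝ) :
    ∀ᶠ τ in atImInfty, thetaChar ε ε' 0 τ ≠ 0 := by
  have hpos : ∀ n : ℤ, n ≠ 0 → (ε / 2) ^ 2 < (n + ε / 2) ^ 2 := by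
    intro n hn
    have h1 : (1 : ℝ) ≤ |(n : ℝ)| := by exact_mod_cast Int.one_le_abs hn
    have h2 : (n : ℝ) ^ 2 = |(n : ℝ)| ^ 2 := (sq_abs _).symm
    have h3 : -(|(n : ℝ)| * |ε|) ≤ n * ε := by rw [← abs_mul]; exact neg_abs_le _
    nlinarith [abs_nonneg ε]
  -- the terms of the series, divided by the absolute value of the term `n = 0`
  let F : ℍ → ℤ → ℂ := fun τ n => (Real.exp (Real.pi * (ε / 2) ^ 2 * τ.im) : ℂ) * thetaTerm ε ε' τ n
  have hF : ∀ τ n, ‖F τ n‖ = Real.exp (-(Real.pi * ((n + ε / 2) ^ 2 - (ε / 2) ^ 2)) * τ.im) := by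
    intro τ n
    rw [norm_mul, norm_thetaTerm, Complex.norm_real, Real.norm_of_nonneg (Real.exp_pos _).le,
      ← Real.exp_add]
    congr 1
    ring
  have htail : Filter.Tendsto (fun τ => ∑' n : ℤ, if n = 0 then 0 else F τ n) atImInfty
      (nhds (∑' _ : ℤ, 0)) := by
    refine tendsto_tsum_of_dominated_convergence
      (bound := fun n => ‖F UpperHalfPlane.I n‖) ?_ (fun n => ?_) ?_
    · exact ((summable_thetaTerm ε ε' UpperHalfPlane.I).mul_left _).norm
    · by_cases hn : n = 0
      · simp [hn]
      · simp only [hn, if_false]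
        refine tendsto_zero_iff_norm_tendsto_zero.mpr ?_
        simp only [hF]
        refine Real.tendsto_exp_atBot.comp ?_
        refine Filter.Tendsto.const_mul_atTop_of_neg ?_ Filter.tendsto_comap
        have := hpos n hn
        have := Real.pi_pos
        nlinarith
    · filter_upwards [(atImInfty_mem {τ : ℍ | 1 ≤ τ.im}).mpr ⟨1, fun τ h => h⟩] with τ hτ n
      by_cases hn : n = 0
      · simp [hn]
      · simp only [hn, if_false, hF, UpperHalfPlane.I_im]
        refine Real.exp_le_exp.mpr ?_
        have h1 : 0 ≤ Real.pi * ((n + ε / 2) ^ 2 - (ε / 2) ^ 2) :=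
          mul_nonneg Real.pi_pos.le (sub_nonneg.mpr (hpos n hn).le)
        have h2 : (1 : ℝ) ≤ τ.im := hτ
        nlinarith
  rw [tsum_zero] at htail
  filter_upwards [(Metric.tendsto_nhds.mp htail) 1 one_pos] with τ hτ h0
  have hsum : Summable (F τ) := (summable_thetaTerm ε ε' τ).mul_left _
  have h1 := hsum.tsum_eq_add_tsum_ite 0
  have h2 : ∑' n, F τ n = 0 := by
    rw [tsum_mul_left, ← thetaChar_eq_tsum, h0, mul_zero]
  have h3 : ‖F τ 0‖ = 1 := by rw [hF]; simp
  rw [h2] at h1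
  have h4 : F τ 0 = -∑' n, (if n = 0 then 0 else F τ n) := eq_neg_of_add_eq_zero_left h1.symm
  rw [dist_zero_right] at hτ
  rw [h4, norm_neg] at h3
  linarith

/-! ### Normalized theta constants -/

/-- The theta constant with characteristic `[1 + 2r₁, 1 + 2r₂]`, multiplied by
`exp (-πi r₁ (r₂ + 1))`. With this normalization it becomes, after division by `η ^ 3`, equivariant
for the right action of `SL(2, ℤ)` on the row vectors `(r₁, r₂)`. -/
def kleinTheta (r₁ r₂ : ℝ) (τ : ℍ) : ℂ :=
  Complex.exp (-(Real.pi * Complex.I * (r₁ * (r₂ + 1)))) * thetaChar (1 + 2 * r₁) (1 + 2 * r₂) 0 τ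

lemma thetaTerm_shift (ε ε' : ℝ) (τ : ℍ) (m n : ℤ) :
    thetaTerm (ε + 2 * m) ε' τ n = thetaTerm ε ε' τ (n + m) := by
  simp only [thetaTerm]
  push_cast
  congr 1
  ring

lemma thetaChar_add_two_mul_left (ε ε' : ℝ) (τ : ℍ) (m : ℤ) :
    thetaChar (ε + 2 * m) ε' 0 τ = thetaChar ε ε' 0 τ := by
  rw [thetaChar_eq_tsum, thetaChar_eq_tsum, funext (thetaTerm_shift ε ε' τ m)]
  exact (Equiv.addRight m).tsum_eq (thetaTerm ε ε' τ)

lemma thetaChar_add_two_mul_right (ε ε' : ℝ) (τ : ℍ) (m : ℤ) :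
    thetaChar ε (ε' + 2 * m) 0 τ =
      Complex.exp (Real.pi * Complex.I * (ε * m)) * thetaChar ε ε' 0 τ := by
  rw [thetaChar_eq_tsum, thetaChar_eq_tsum, ← tsum_mul_left]
  refine tsum_congr fun n => ?_
  rw [thetaTerm, thetaTerm, ← Complex.exp_add, Complex.exp_eq_exp_iff_exists_int]
  refine ⟨n * m, ?_⟩
  push_cast
  ring

lemma thetaChar_neg (ε ε' : ℝ) (τ : ℍ) : thetaChar (-ε) (-ε') 0 τ = thetaChar ε ε' 0 τ := by
  rw [thetaChar_eq_tsum, thetaChar_eq_tsum, ← (Equiv.neg ℤ).tsum_eq]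
  refine tsum_congr fun n => ?_
  simp only [thetaTerm, Equiv.neg_apply]
  push_cast
  congr 1
  ring

lemma kleinTheta_neg (r₁ r₂ : ℝ) (τ : ℍ) : kleinTheta (-r₁) (-r₂) τ = -kleinTheta r₁ r₂ τ := by
  have h : thetaChar (1 + 2 * -r₁) (1 + 2 * -r₂) 0 τ =
      Complex.exp (-(Real.pi * Complex.I * (1 + 2 * r₁))) *
        thetaChar (1 + 2 * r₁) (1 + 2 * r₂) 0 τ := by
    have h1 := thetaChar_add_two_mul_left (-(1 + 2 * -r₁)) (-(1 + 2 * -r₂)) τ 1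
    have h2 := thetaChar_add_two_mul_right (1 + 2 * r₁) (1 + 2 * r₂) τ (-1)
    push_cast at h1 h2
    rw [← thetaChar_neg, ← h1, show -(1 + 2 * -r₁) + 2 * 1 = 1 + 2 * r₁ by ring,
      show -(1 + 2 * -r₂) = 1 + 2 * r₂ + 2 * -1 by ring, h2, mul_neg_one, mul_neg]
  have hneg : ∀ z : ℂ, -Complex.exp z = Complex.exp (Real.pi * Complex.I + z) := fun z => by
    rw [Complex.exp_add, Complex.exp_pi_mul_I, neg_one_mul]
  rw [kleinTheta, kleinTheta, h, ← mul_assoc, ← Complex.exp_add,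
    ← neg_mul (Complex.exp _), hneg]
  congr 1
  rw [Complex.exp_eq_exp_iff_exists_int]
  refine ⟨-1, ?_⟩
  push_cast
  ring

/-- Translation by `2ℤ × 2ℤ`, where no sign intervenes. -/
lemma kleinTheta_add_two_mul (r₁ r₂ : ℝ) (m n : ℤ) (τ : ℍ) :
    kleinTheta (r₁ + 2 * m) (r₂ + 2 * n) τ =
      Complex.exp (2 * Real.pi * Complex.I * (r₁ * n - r₂ * m)) * kleinTheta r₁ r₂ τ := by
  have h : thetaChar (1 + 2 * (r₁ + 2 * m)) (1 + 2 * (r₂ + 2 * n)) 0 τ =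
      Complex.exp (Real.pi * Complex.I * ((1 + 2 * r₁) * (2 * n))) *
        thetaChar (1 + 2 * r₁) (1 + 2 * r₂) 0 τ := by
    have h1 := thetaChar_add_two_mul_left (1 + 2 * r₁) (1 + 2 * (r₂ + 2 * n)) τ (2 * m)
    have h2 := thetaChar_add_two_mul_right (1 + 2 * r₁) (1 + 2 * r₂) τ (2 * n)
    push_cast at h1 h2
    rw [show 1 + 2 * (r₁ + 2 * (m : ℝ)) = 1 + 2 * r₁ + 2 * (2 * m) by ring, h1, ← h2]
    congr 1
    ring
  rw [kleinTheta, kleinTheta, h, ← mul_assoc (Complex.exp _), ← mul_assoc (Complex.exp _)]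
  congr 1
  rw [← Complex.exp_add, ← Complex.exp_add, Complex.exp_eq_exp_iff_exists_int]
  refine ⟨n - m - 2 * m * n, ?_⟩
  push_cast
  ring

lemma kleinTheta_T_smul (r₁ r₂ : ℝ) (τ : ℍ) :
    kleinTheta r₁ r₂ (ModularGroup.T • τ) =
      Complex.exp (Real.pi * Complex.I / 4) * kleinTheta r₁ (r₁ + r₂) τ := by
  simp only [kleinTheta, thetaChar_eq_tsum, ← tsum_mul_left]
  refine tsum_congr fun n => ?_
  rw [thetaTerm, thetaTerm, modular_T_smul, ← Complex.exp_add, ← Complex.exp_add,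
    ← Complex.exp_add, Complex.exp_eq_exp_iff_exists_int]
  obtain ⟨k, hk⟩ := Int.even_mul_succ_self n
  refine ⟨k, ?_⟩
  have hk' : (n : ℂ) * (n + 1) = k + k := by exact_mod_cast hk
  simp only [coe_vadd]
  push_cast
  linear_combination (Real.pi * Complex.I) * hk'

lemma coe_S_smul (τ : ℍ) : ((ModularGroup.S • τ : ℍ) : ℂ) = -1 / τ := by
  rw [modular_S_smul]
  simp [neg_div, inv_neg]

lemma cpow_half_ne_zero (τ : ℍ) : (-Complex.I * τ) ^ (1 / 2 : ℂ) ≠ 0 := fun h => by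
  simpa [τ.ne_zero] using ((Complex.cpow_eq_zero_iff _ _).mp h).1

/-- The inversion formula, an instance of the functional equation of the Jacobi theta function. -/
lemma kleinTheta_S_smul (r₁ r₂ : ℝ) (τ : ℍ) :
    kleinTheta r₁ r₂ (ModularGroup.S • τ) =
      -Complex.I * (-Complex.I * τ) ^ (1 / 2 : ℂ) * kleinTheta r₂ (-r₁) τ := by
  have hτ : (τ : ℂ) ≠ 0 := τ.ne_zero
  have hroot : (-Complex.I * τ) ^ (1 / 2 : ℂ) ≠ 0 := cpow_half_ne_zero τ
  have hI : -Complex.I = Complex.exp (-(Real.pi / 2 * Complex.I)) := by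
    rw [Complex.exp_neg, Complex.exp_pi_div_two_mul_I, Complex.inv_I]
  -- `x = z / τ`, where `z` is the argument of the theta function on the right; the argument on the
  -- left differs from `x` by the period `-1 / τ`
  set x : ℂ := ((1 / 2 + r₂) * τ + (1 / 2 - r₁)) / τ with hx
  have h1 : jacobiTheta₂ (((1 + 2 * r₁ : ℝ) : ℂ) / 2 * (-1 / τ) + ((1 + 2 * r₂ : ℝ) : ℂ) / 2)
      (-1 / τ) = Complex.exp (-Real.pi * Complex.I * (-1 / τ + 2 * x)) *
        jacobiTheta₂ x (-1 / τ) := by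
    rw [← jacobiTheta₂_add_left']
    congr 1
    rw [hx]
    push_cast
    field_simp
    ring
  have h2 : jacobiTheta₂ (((1 + 2 * r₂ : ℝ) : ℂ) / 2 * τ + ((1 + 2 * -r₁ : ℝ) : ℂ) / 2) τ =
      1 / (-Complex.I * τ) ^ (1 / 2 : ℂ) *
        Complex.exp (-Real.pi * Complex.I * (x * τ) ^ 2 / τ) * jacobiTheta₂ x (-1 / τ) := by
    have hz : ((1 + 2 * r₂ : ℝ) : ℂ) / 2 * τ + ((1 + 2 * -r₁ : ℝ) : ℂ) / 2 = x * τ := by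
      rw [hx]
      push_cast
      field_simp
      ring
    rw [hz, jacobiTheta₂_functional_equation, mul_div_assoc x, div_self hτ, mul_one]
  rw [kleinTheta, kleinTheta, thetaChar_eq_jacobiTheta₂, thetaChar_eq_jacobiTheta₂, coe_S_smul,
    h1, h2]
  have hexp : ∀ a b c d e f g R J : ℂ, R ≠ 0 → a + b + c = g + d + e + f →
      Complex.exp a * (Complex.exp b * (Complex.exp c * J)) =
        Complex.exp g * R * (Complex.exp d * (Complex.exp e * (1 / R * Complex.exp f * J))) := by
    intro a b c d e f g R J hR h
    have : Complex.exp a * Complex.exp b * Complex.exp c =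
        Complex.exp g * Complex.exp d * Complex.exp e * Complex.exp f := by
      simp only [← Complex.exp_add, h]
    field_simp
    linear_combination J * this
  rw [show -Complex.I * (-Complex.I * (τ : ℂ)) ^ (1 / 2 : ℂ) =
    Complex.exp (-(Real.pi / 2 * Complex.I)) * (-Complex.I * (τ : ℂ)) ^ (1 / 2 : ℂ) by rw [← hI]]
  refine hexp _ _ _ _ _ _ _ _ _ hroot ?_
  rw [hx]
  push_cast
  field_simp
  ring

lemma etaH_T_smul (τ : ℍ) :
    etaH (ModularGroup.T • τ) = Complex.exp (2 * Real.pi * Complex.I / 24) * etaH τ := by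
  have hq : ∀ n, ModularForm.eta_q n (1 + τ) = ModularForm.eta_q n τ := fun n => by
    rw [ModularForm.eta_q_eq_cexp, ModularForm.eta_q_eq_cexp, Complex.exp_eq_exp_iff_exists_int]
    refine ⟨n + 1, ?_⟩
    push_cast
    ring
  rw [etaH, etaH, modular_T_smul, coe_vadd, ModularForm.eta, ModularForm.eta, ← mul_assoc]
  simp only [Complex.ofReal_one, hq]
  congr 1
  rw [Function.Periodic.qParam, Function.Periodic.qParam, ← Complex.exp_add]
  congr 1
  push_cast
  ring

lemma etaH_S_smul (τ : ℍ) :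
    etaH (ModularGroup.S • τ) = (-Complex.I * τ) ^ (1 / 2 : ℂ) * etaH τ := by
  have h := ModularForm.eta_comp_eq_csqrt_I_inv τ.2
  have hI : Complex.sqrt Complex.I ≠ 0 := fun h => by
    simpa using ((Complex.cpow_eq_zero_iff _ _).mp h).1
  have hre : 0 < (-Complex.I * τ).re := by simpa using τ.im_pos
  have harg := abs_lt.mp (Complex.abs_arg_lt_pi_div_two_iff.mpr (Or.inl hre))
  have hsqrt : Complex.sqrt τ = Complex.sqrt Complex.I * (-Complex.I * τ) ^ (1 / 2 : ℂ) := by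
    conv_lhs => rw [show (τ : ℂ) = Complex.I * (-Complex.I * τ) by
      rw [← mul_assoc, mul_neg, Complex.I_mul_I, neg_neg, one_mul]]
    have hz : -Complex.I * τ ≠ 0 := fun h => by simp [h] at hre
    have hlog := (Complex.log_mul_eq_add_log_iff Complex.I_ne_zero hz).mpr (by
      rw [Complex.arg_I]
      constructor <;> linarith [Real.pi_pos])
    rw [Complex.sqrt, Complex.sqrt, Complex.cpow_def_of_ne_zero (mul_ne_zero Complex.I_ne_zero hz),
      Complex.cpow_def_of_ne_zero Complex.I_ne_zero, Complex.cpow_def_of_ne_zero hz, hlog,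
      ← Complex.exp_add]
    congr 1
    ring
  rw [etaH, coe_S_smul]
  refine h.trans ?_
  simp only [Pi.smul_apply, Pi.mul_apply, smul_eq_mul, hsqrt, etaH]
  field_simp

/-- The quotient of a normalized theta constant by `η ^ 3`. It is a nonzero constant multiple of
the Klein form attached to `(r₁, r₂)`. -/
def kleinForm (r₁ r₂ : ℝ) (τ : ℍ) : ℂ := kleinTheta r₁ r₂ τ / etaH τ ^ 3

lemma kleinForm_T_smul (r₁ r₂ : ℝ) (τ : ℍ) :
    kleinForm r₁ r₂ (ModularGroup.T • τ) = kleinForm r₁ (r₁ + r₂) τ := by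
  rw [kleinForm, kleinForm, kleinTheta_T_smul, etaH_T_smul, mul_pow, ← Complex.exp_nat_mul,
    show ((3 : ℕ) : ℂ) * (2 * Real.pi * Complex.I / 24) = Real.pi * Complex.I / 4 by
      push_cast; ring]
  exact mul_div_mul_left _ _ (Complex.exp_ne_zero _)

lemma kleinForm_S_smul (r₁ r₂ : ℝ) (τ : ℍ) :
    kleinForm r₁ r₂ (ModularGroup.S • τ) * τ = kleinForm r₂ (-r₁) τ := by
  have hτ : (τ : ℂ) ≠ 0 := τ.ne_zero
  have hη := etaH_ne_zero τ
  have hsq : ((-Complex.I * τ) ^ (1 / 2 : ℂ)) ^ 2 = -Complex.I * τ := by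
    rw [← Complex.cpow_nat_mul]
    simp
  have hroot : (-Complex.I * τ) ^ (1 / 2 : ℂ) ≠ 0 := cpow_half_ne_zero τ
  rw [kleinForm, kleinForm, kleinTheta_S_smul, etaH_S_smul]
  generalize (-Complex.I * (τ : ℂ)) ^ (1 / 2 : ℂ) = R at *
  field_simp
  linear_combination -kleinTheta r₂ (-r₁) τ * hsq

/-- The equivariance of the Klein forms. Both sides are compatible with products of matrices, so
that it is enough to treat the generators `S` and `T`. -/
lemma kleinForm_smul (M : SL(2, ℤ)) (r₁ r₂ : ℝ) (τ : ℍ) :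
    kleinForm r₁ r₂ (M • τ) * lowerRow M τ =
      kleinForm (M 0 0 * r₁ + M 1 0 * r₂) (M 0 1 * r₁ + M 1 1 * r₂) τ := by
  have hM : M ∈ Subgroup.closure {ModularGroup.S, ModularGroup.T} := by
    simp [SpecialLinearGroup.SL2Z_generators]
  induction hM using Subgroup.closure_induction generalizing r₁ r₂ τ with
  | mem M hM =>
    rcases hM with rfl | rfl
    · simpa [lowerRow, ModularGroup.S] using kleinForm_S_smul r₁ r₂ τ
    · simpa [lowerRow, ModularGroup.T] using kleinForm_T_smul r₁ r₂ τ
  | one => simp [lowerRow]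
  | mul M N _ _ hM hN =>
    rw [mul_smul, lowerRow_mul, ← mul_assoc, hM, hN]
    simp only [Matrix.SpecialLinearGroup.coe_mul, Matrix.mul_apply, Fin.sum_univ_two]
    push_cast
    congr 1 <;> ring
  | inv M _ hM =>
    have h := hM (M⁻¹ 0 0 * r₁ + M⁻¹ 1 0 * r₂) (M⁻¹ 0 1 * r₁ + M⁻¹ 1 1 * r₂) (M⁻¹ • τ)
    have h1 : lowerRow M (M⁻¹ • τ) * lowerRow M⁻¹ τ = 1 := by
      rw [← lowerRow_mul, mul_inv_cancel]
      simp [lowerRow]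
    have hdet : (M 0 0 : ℝ) * M 1 1 - M 0 1 * M 1 0 = 1 := by
      have := M.det_coe
      rw [Matrix.det_fin_two] at this
      exact_mod_cast this
    rw [smul_inv_smul] at h
    have e1 : (M 0 0 : ℝ) * (M⁻¹ 0 0 * r₁ + M⁻¹ 1 0 * r₂) +
        M 1 0 * (M⁻¹ 0 1 * r₁ + M⁻¹ 1 1 * r₂) = r₁ := by
      simp [Matrix.SpecialLinearGroup.SL2_inv_expl]
      linear_combination r₁ * hdet
    have e2 : (M 0 1 : ℝ) * (M⁻¹ 0 0 * r₁ + M⁻¹ 1 0 * r₂) +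
        M 1 1 * (M⁻¹ 0 1 * r₁ + M⁻¹ 1 1 * r₂) = r₂ := by
      simp [Matrix.SpecialLinearGroup.SL2_inv_expl]
      linear_combination r₂ * hdet
    rw [e1, e2] at h
    rw [← h, mul_assoc, h1, mul_one]

/-! ### The product of two theta constants -/

/-- The product `θ[1/5, 1/5] · θ[1/5, 9/5]` belongs to the vectors `(-2/5, ∓2/5)`; the constant
removes the normalizing factors of the two theta constants. -/
lemma thetaProd_eq_kleinTheta (τ : ℍ) :
    thetaProd τ = Complex.exp (-(4 * Real.pi * Complex.I / 5)) *
      (kleinTheta (-(2 / 5)) (-(2 / 5)) τ * kleinTheta (-(2 / 5)) (2 / 5) τ) := by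
  have h : Complex.exp (-(4 * Real.pi * Complex.I / 5)) *
      Complex.exp (-(Real.pi * Complex.I * (((-(2 / 5) : ℝ) : ℂ) * (((-(2 / 5) : ℝ) : ℂ) + 1)))) *
      Complex.exp (-(Real.pi * Complex.I * (((-(2 / 5) : ℝ) : ℂ) * (((2 / 5 : ℝ) : ℂ) + 1)))) =
      1 := by
    rw [← Complex.exp_add, ← Complex.exp_add]
    refine (congrArg Complex.exp ?_).trans Complex.exp_zero
    push_cast
    ring
  rw [thetaProd, kleinTheta, kleinTheta, show (1 : ℝ) + 2 * -(2 / 5) = 1 / 5 by norm_num,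
    show (1 : ℝ) + 2 * (2 / 5) = 9 / 5 by norm_num]
  linear_combination (-(thetaChar (1 / 5) (1 / 5) 0 τ * thetaChar (1 / 5) (9 / 5) 0 τ)) * h

lemma kleinTheta_eq_kleinForm (r₁ r₂ : ℝ) (τ : ℍ) :
    kleinTheta r₁ r₂ τ = kleinForm r₁ r₂ τ * etaH τ ^ 3 :=
  (div_mul_cancel₀ _ (pow_ne_zero 3 (etaH_ne_zero τ))).symm

/-- Two Klein forms contribute the weight `-2` and `η ^ 6` contributes the weight `3`. -/
lemma thetaProd_smul (M : SL(2, ℤ)) (τ : ℍ) :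
    thetaProd (M • τ) = nuEta M ^ 6 * lowerRow M τ *
      (Complex.exp (-(4 * Real.pi * Complex.I / 5)) *
        (kleinTheta (M 0 0 * -(2 / 5) + M 1 0 * -(2 / 5)) (M 0 1 * -(2 / 5) + M 1 1 * -(2 / 5)) τ *
          kleinTheta (M 0 0 * -(2 / 5) + M 1 0 * (2 / 5))
            (M 0 1 * -(2 / 5) + M 1 1 * (2 / 5)) τ)) := by
  have h6 : autFactor (1 / 2) M τ ^ 6 = lowerRow M τ ^ 3 := by
    rw [← autFactor_half_sq]; ring
  rw [thetaProd_eq_kleinTheta]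
  simp only [kleinTheta_eq_kleinForm, ← kleinForm_smul, etaH_smul]
  linear_combination (nuEta M ^ 6 * etaH τ ^ 6 * Complex.exp (-(4 * Real.pi * Complex.I / 5)) *
    kleinForm (-(2 / 5)) (-(2 / 5)) (M • τ) * kleinForm (-(2 / 5)) (2 / 5) (M • τ)) * h6

lemma kleinTheta_isBoundedAtImInfty (r₁ r₂ : ℝ) : IsBoundedAtImInfty (kleinTheta r₁ r₂) :=
  (Filter.const_boundedAtFilter atImInfty _).mul (thetaChar_isBoundedAtImInfty _ _)

lemma exists_thetaProd_ne_zero : ∃ τ : ℍ, thetaProd τ ≠ 0 := by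
  have h : |(1 / 5 : ℝ)| < 1 := by norm_num [abs_of_pos]
  obtain ⟨τ, h1, h2⟩ := ((eventually_thetaChar_ne_zero h (1 / 5)).and
    (eventually_thetaChar_ne_zero h (9 / 5))).exists
  exact ⟨τ, mul_ne_zero h1 h2⟩

lemma Cong5.exists_eq {A B : Matrix (Fin 2) (Fin 2) ℤ} (h : Cong5 A B) (i j : Fin 2) :
    ∃ k : ℤ, A i j = B i j + 5 * k := by
  obtain ⟨k, hk⟩ := (h i j).symm.dvd
  exact ⟨k, by linarith⟩

lemma Cong5.not_of_entry {A B C : Matrix (Fin 2) (Fin 2) ℤ} (h : Cong5 A B) (i j : Fin 2)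
    (hBC : ¬ B i j ≡ C i j [ZMOD 5]) : ¬ Cong5 A C :=
  fun h' => hBC ((h i j).symm.trans (h' i j))

/-- A matrix of the theta group permutes the vectors `±(2/5, 2/5)`, `±(2/5, -2/5)` modulo
`2ℤ × 2ℤ`, and exchanges the two pairs or preserves them. The exponent `E` collects the
translation factors, and the sign `-1 = exp (-πi)` from `kleinTheta_neg` when the pairs
are exchanged. -/
lemma kleinTheta_mul_kleinTheta {M : SL(2, ℤ)} (hM : M ∈ GammaTheta5) (τ : ℍ) :
    kleinTheta (M 0 0 * -(2 / 5) + M 1 0 * -(2 / 5)) (M 0 1 * -(2 / 5) + M 1 1 * -(2 / 5)) τ *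
        kleinTheta (M 0 0 * -(2 / 5) + M 1 0 * (2 / 5)) (M 0 1 * -(2 / 5) + M 1 1 * (2 / 5)) τ =
      Complex.exp (Real.pi * Complex.I / 5 * (exponentE M : ℂ)) *
        (kleinTheta (-(2 / 5)) (-(2 / 5)) τ * kleinTheta (-(2 / 5)) (2 / 5) τ) := by
  have n1 : kleinTheta (2 / 5) (2 / 5) τ = -kleinTheta (-(2 / 5)) (-(2 / 5)) τ := by
    rw [kleinTheta_neg, neg_neg]
  have n2 : kleinTheta (2 / 5) (-(2 / 5)) τ = -kleinTheta (-(2 / 5)) (2 / 5) τ := by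
    rw [← kleinTheta_neg, neg_neg]
  have hneg : ∀ z : ℂ, -Complex.exp z = Complex.exp (-(Real.pi * Complex.I) + z) := fun z => by
    rw [Complex.exp_add, Complex.exp_neg, Complex.exp_pi_mul_I]
    norm_num
  -- in each case the integer given at the end is the difference of the two exponents in units
  -- of `2πi`
  rcases hM with h | h | h | h
  · have hE : exponentE M = -(4 * (M 0 1 : ℝ) / 5) - 8 * M 0 0 * M 0 1 / 5 -
        8 * M 1 0 * M 1 1 / 5 := by
      rw [exponentE, if_pos h]
    obtain ⟨A, hA⟩ := h.exists_eq 0 0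
    obtain ⟨B, hB⟩ := h.exists_eq 0 1
    obtain ⟨C, hC⟩ := h.exists_eq 1 0
    obtain ⟨D, hD⟩ := h.exists_eq 1 1
    simp only [Matrix.of_apply, Matrix.cons_val', Matrix.cons_val_zero, Matrix.cons_val_one,
      Matrix.cons_val_fin_one] at hA hB hC hD
    have k1 := kleinTheta_add_two_mul (-(2 / 5)) (-(2 / 5)) (-(A + C)) (-(B + D)) τ
    have k2 := kleinTheta_add_two_mul (-(2 / 5)) (2 / 5) (-(A - C)) (-(B - D)) τ
    rw [hE, hA, hB, hC, hD]
    convert congrArg₂ (· * ·) k1 k2 using 1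
    · push_cast
      congr 2 <;> ring
    · rw [mul_mul_mul_comm, ← Complex.exp_add]
      congr 1
      rw [Complex.exp_eq_exp_iff_exists_int]
      refine ⟨-(2 * B + 4 * A * B + 4 * C * D), ?_⟩
      push_cast
      ring
  · have hE : exponentE M = -(6 * (M 0 1 : ℝ) / 5) - 8 * M 0 0 * M 0 1 / 5 -
        8 * M 1 0 * M 1 1 / 5 := by
      rw [exponentE, if_neg (h.not_of_entry 0 0 (by decide)), if_pos h]
    obtain ⟨A, hA⟩ := h.exists_eq 0 0
    obtain ⟨B, hB⟩ := h.exists_eq 0 1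
    obtain ⟨C, hC⟩ := h.exists_eq 1 0
    obtain ⟨D, hD⟩ := h.exists_eq 1 1
    simp only [Matrix.of_apply, Matrix.cons_val', Matrix.cons_val_zero, Matrix.cons_val_one,
      Matrix.cons_val_fin_one] at hA hB hC hD
    have k1 := kleinTheta_add_two_mul (2 / 5) (2 / 5) (-(A + C)) (-(B + D)) τ
    have k2 := kleinTheta_add_two_mul (2 / 5) (-(2 / 5)) (-(A - C)) (-(B - D)) τ
    rw [n1] at k1
    rw [n2] at k2
    rw [hE, hA, hB, hC, hD]
    convert congrArg₂ (· * ·) k1 k2 using 1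
    · push_cast
      congr 2 <;> ring
    · rw [mul_mul_mul_comm, ← Complex.exp_add, neg_mul_neg]
      congr 1
      rw [Complex.exp_eq_exp_iff_exists_int]
      refine ⟨-(-B + 4 * A * B + 4 * C * D), ?_⟩
      push_cast
      ring
  · have hE : exponentE M = -5 - 4 * (M 1 1 : ℝ) / 5 - 8 * M 0 0 * M 0 1 / 5 -
        8 * M 1 0 * M 1 1 / 5 := by
      rw [exponentE, if_neg (h.not_of_entry 0 0 (by decide)),
        if_neg (h.not_of_entry 0 0 (by decide)), if_pos h]
    obtain ⟨A, hA⟩ := h.exists_eq 0 0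
    obtain ⟨B, hB⟩ := h.exists_eq 0 1
    obtain ⟨C, hC⟩ := h.exists_eq 1 0
    obtain ⟨D, hD⟩ := h.exists_eq 1 1
    simp only [Matrix.of_apply, Matrix.cons_val', Matrix.cons_val_zero, Matrix.cons_val_one,
      Matrix.cons_val_fin_one] at hA hB hC hD
    have k1 := kleinTheta_add_two_mul (-(2 / 5)) (2 / 5) (-(A + C)) (-(B + D)) τ
    have k2 := kleinTheta_add_two_mul (2 / 5) (2 / 5) (-(A - C)) (-(B - D)) τ
    rw [n1] at k2
    rw [hE, hA, hB, hC, hD]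
    convert congrArg₂ (· * ·) k1 k2 using 1
    · push_cast
      congr 2 <;> ring
    · rw [mul_mul_mul_comm, ← Complex.exp_add, mul_neg, mul_neg, ← neg_mul (Complex.exp _), hneg,
        mul_comm (kleinTheta (-(2 / 5)) (2 / 5) τ)]
      congr 1
      rw [Complex.exp_eq_exp_iff_exists_int]
      refine ⟨-(2 * D + 4 * A * B + 4 * C * D), ?_⟩
      push_cast
      ring
  · have hE : exponentE M = -5 + 4 * (M 1 1 : ℝ) / 5 - 8 * M 0 0 * M 0 1 / 5 -
        8 * M 1 0 * M 1 1 / 5 := by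
      rw [exponentE, if_neg (h.not_of_entry 0 0 (by decide)),
        if_neg (h.not_of_entry 0 0 (by decide)), if_neg (h.not_of_entry 0 1 (by decide)), if_pos h]
    obtain ⟨A, hA⟩ := h.exists_eq 0 0
    obtain ⟨B, hB⟩ := h.exists_eq 0 1
    obtain ⟨C, hC⟩ := h.exists_eq 1 0
    obtain ⟨D, hD⟩ := h.exists_eq 1 1
    simp only [Matrix.of_apply, Matrix.cons_val', Matrix.cons_val_zero, Matrix.cons_val_one,
      Matrix.cons_val_fin_one] at hA hB hC hD
    have k1 := kleinTheta_add_two_mul (2 / 5) (-(2 / 5)) (-(A + C)) (-(B + D)) τ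
    have k2 := kleinTheta_add_two_mul (-(2 / 5)) (-(2 / 5)) (-(A - C)) (-(B - D)) τ
    rw [n2] at k1
    rw [hE, hA, hB, hC, hD]
    convert congrArg₂ (· * ·) k1 k2 using 1
    · push_cast
      congr 2 <;> ring
    · rw [mul_mul_mul_comm, ← Complex.exp_add, neg_mul, mul_neg, ← neg_mul (Complex.exp _), hneg,
        mul_comm (kleinTheta (-(2 / 5)) (2 / 5) τ)]
      congr 1
      rw [Complex.exp_eq_exp_iff_exists_int]
      refine ⟨-(-2 * D + 4 * A * B + 4 * C * D), ?_⟩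
      push_cast
      ring

lemma thetaProd_smul_of_mem {M : SL(2, ℤ)} (hM : M ∈ GammaTheta5) (τ : ℍ) :
    thetaProd (M • τ) =
      nuEta M ^ 6 * Complex.exp (Real.pi * Complex.I / 5 * (exponentE M : ℂ)) *
        autFactor 1 M τ * thetaProd τ := by
  rw [thetaProd_smul, kleinTheta_mul_kleinTheta hM, autFactor_one, thetaProd_eq_kleinTheta]
  ring

theorem thetaProd_isModularForm : IsModularFormWithMultiplier GammaTheta5 1 thetaProd
    (fun M => nuEta M ^ 6 *
      Complex.exp ((Real.pi : ℂ) * Complex.I / 5 * (exponentE M : ℂ))) where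
  holo := (differentiableOn_thetaChar _ _).mul (differentiableOn_thetaChar _ _)
  bdd_at_cusps M := by
    have h := (Filter.const_boundedAtFilter atImInfty
      (nuEta M ^ 6 * Complex.exp (-(4 * Real.pi * Complex.I / 5)))).mul
      ((kleinTheta_isBoundedAtImInfty (M 0 0 * -(2 / 5) + M 1 0 * -(2 / 5))
        (M 0 1 * -(2 / 5) + M 1 1 * -(2 / 5))).mul
      (kleinTheta_isBoundedAtImInfty (M 0 0 * -(2 / 5) + M 1 0 * (2 / 5))
        (M 0 1 * -(2 / 5) + M 1 1 * (2 / 5))))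
    refine Asymptotics.IsBigO.congr_left h fun τ => ?_
    have h0 := lowerRow_ne_zero M τ
    rw [autFactor_one, thetaProd_smul, eq_div_iff h0]
    simp only [Pi.mul_apply, Function.const_apply]
    ring
  ne_zero := exists_thetaProd_ne_zero
  norm_eq_one M _ := by
    rw [norm_mul, norm_pow, norm_nuEta, one_pow, one_mul, Complex.norm_exp]
    have : (Real.pi : ℂ) * Complex.I / 5 * (exponentE M : ℂ) =
        ((Real.pi / 5 * exponentE M : ℝ) : ℂ) * Complex.I := by
      push_cast
      ring
    rw [this, Complex.re_ofReal_mul, Complex.I_re, mul_zero, Real.exp_zero]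
  consistent M hM N hN τ := by
    -- in weight one the factors of automorphy cancel, so that one point `σ` at which the function
    -- does not vanish suffices
    obtain ⟨σ, hσ⟩ := exists_thetaProd_ne_zero
    have h := thetaProd_smul_of_mem (GammaTheta5.mul_mem hM hN) σ
    rw [mul_smul, thetaProd_smul_of_mem hM, thetaProd_smul_of_mem hN] at h
    simp only [autFactor_one, lowerRow_mul] at h ⊢
    have h1 := lowerRow_ne_zero M (N • σ)
    have h2 := lowerRow_ne_zero N σ
    have hν : nuEta (M * N) ^ 6 *
          Complex.exp (Real.pi * Complex.I / 5 * (exponentE (M * N) : ℂ)) =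
        nuEta M ^ 6 * Complex.exp (Real.pi * Complex.I / 5 * (exponentE M : ℂ)) *
          (nuEta N ^ 6 * Complex.exp (Real.pi * Complex.I / 5 * (exponentE N : ℂ))) := by
      refine mul_right_cancel₀ (mul_ne_zero (mul_ne_zero h1 h2) hσ) ?_
      linear_combination -h
    rw [hν]
    ring
  transform M hM τ := thetaProd_smul_of_mem hM τ

end

end ThetaLevelFive

theorem mainTheorem3 :
    ThetaLevelFive.IsModularFormWithMultiplier ⊤ (1 / 2)
      ThetaLevelFive.etaH ThetaLevelFive.nuEta ∧
    ThetaLevelFive.IsModularFormWithMultiplier ThetaLevelFive.GammaTheta5 1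
      ThetaLevelFive.thetaProd
      (fun M => ThetaLevelFive.nuEta M ^ 6 *
        Complex.exp ((Real.pi : ℂ) * Complex.I / 5 * (ThetaLevelFive.exponentE M : ℂ))) :=
  ⟨ThetaLevelFive.eta_isModularForm, ThetaLevelFive.thetaProd_isModularForm⟩
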